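/- For complex numbers write ${}_3F_2[a,b,c;d,e;1]=\sum_{n\ge0}\frac{(a)_n(b)_n(c)_n}{n!\,(d)_n(e)_n}$. Two parameter arrays $[a,b,c;d,e]$ are called Thomae-related if the associated $5$-tuples $(d+e-b-c,\;d+e-c-a,\;d+e-a-b,\;d,\;e)$ agree up to a permutation. For non-negative integers put $$I(h,i,j,k,l)=\int_0^1\!\!\int_0^1\frac{x^h(1-x)^iy^k(1-y)^j}{(1-xy)^{i+j-l+1}}\,dx\,dy ,$$ which is a multiple of ${}_3F_2[h+1,k+1,i+j-l+1;h+i+2,k+j+2;1]$. Let $\mathscr P=\{h,i,j,k,l,\;j+k-h,\;k+l-i,\;l+h-j,\;h+i-k,\;i+j-l\}$ (ten symbols), and let $\sigma=(h\,k)(i\,j)$ and $\tau=(h\,i\,j\,k\,l)$ act on $\mathscr P$ by linearity; let $\varphi=(h\;\,i+j-l)(i\;\,l+h-j)(j+k-h\;\,k+l-i)$, $\mathbf T=\langle\sigma,\tau\rangle$, $\mathbf\Phi=\langle\varphi,\sigma,\tau\rangle$. The Rhin–Viola conjecture says, for non-negative integers $h,\dots,l,h',\dots,l'$: (a) if $I(h,i,j,k,l)=I(h',i',j',k',l')$,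 then some $\rho\in\mathbf T$ has $\rho(h)=h',\dots,\rho(l)=l'$; (b) if moreover all elements of $\mathscr P$ are non-negative for both $5$-tuples and $I(h,i,j,k,l)/I(h',i',j',k',l')\in\mathbf Q$, then some $\rho\in\mathbf\Phi$ has $\rho(h)=h',\dots,\rho(l)=l'$ (in (b) the equality of the integrals is not assumed). **Theorem.** (i) If $\alpha,\beta,\gamma\in\mathbf C$ are such that $2\alpha+\beta+1$ and $2\beta+\alpha+1$ are not non-positive integers and $\Re(2\alpha+2\beta-\gamma)>0$, then both of the following series converge and $${}_3F_2[\alpha+1,\beta+1,\gamma;\,2\alpha+\beta+1,2\beta+\alpha+1;1]=\frac{2(\alpha+\beta)}{2(\alpha+\beta)-\gamma}\;{}_3F_2[\alpha,\beta,\gamma;\,2\alpha+\beta+1,2\beta+\alpha+1;1].\qquad(*)$$ The following five relations of Sato hold: \begin{align*} I(1,1,1,1,1)&=5-3\zeta(2)=I(3,1,1,2,0),\\ I(3,1,2,2,1)&=79/4-12\zeta(2)=I(4,2,2,3,0),\\ I(3,1,2,1,1)&=3\zeta(2)-59/12=I(3,3,1,3,0),\\ I(3,2,2,2,1)&=10\zeta(2)-148/9=I(5,1,3,2,1),\\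 I(3,0,3,1,1)&=9\zeta(2)-59/4=9\,I(3,3,1,2,1). \end{align*} All five are counterexamples to (b), and the first four are also counterexamples to (a). They are the specializations of $(*)$ at $(\alpha,\beta,\gamma)=(1,1,2),(2,1,3),(2,1,4),(2,1,2),(2,1,4)$ respectively, in the following sense: the array $[h+1,k+1,i+j-l+1;h+i+2,k+j+2]$ of the left (right) integral is Thomae-related to the array $P=[a,b,c;d,e]$ on the left (right) side of $(*)$; that integral equals $\frac{h!\,i!\,j!\,k!\,l!}{\Gamma(d+e-a-b-c)\Gamma(d)\Gamma(e)}$ times the series with array $P$; and, with these non-zero factors, $(*)$ becomes the stated relation between the two integrals. (ii) For every integer $\alpha\ge1$, $$I(2\alpha-1,2\alpha-1,\alpha,2\alpha-1,\alpha)=I(2\alpha+1,2\alpha-1,\alpha,2\alpha,\alpha-1),$$ and this pair of $5$-tuples is a counterexample to both (a) and (b): the integrals are non-zero, all elements of $\mathscr P$ are non-negative for both tuples, and no $\rho\in\mathbf\Phi$ (hence none in $\mathbf T$) carries the first tuple to the second. Moreover $I(2\alpha-1,2\alpha-1,\alpha,2\alpha-1,\alpha)\to0$ as $\alpha\to\infty$,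 so that the integrals occurring in counterexamples to both (a) and (b) take infinitely many different values. -/

import Mathlib

open Set Filter Topology MeasureTheory

/-! ## Hypergeometric series `₃F₂` at `1` -/

/-- The array of parameters `[a, b, c; d, e]` of a `₃F₂`-series. -/
structure HypParams where
  a : ℂ
  b : ℂ
  c : ℂ
  d : ℂ
  e : ℂ

namespace HypParams

/-- The `n`-th term `(a)ₙ (b)ₙ (c)ₙ / (n! (d)ₙ (e)ₙ)` of the `₃F₂`-series at `1`. -/
noncomputable def term (P : HypParams) (n : ℕ) : ℂ :=
  ((ascPochhammer ℂ n).eval P.a * (ascPochhammer ℂ n).eval P.b * (ascPochhammer ℂ n).eval P.c) /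
    ((n.factorial : ℂ) * (ascPochhammer ℂ n).eval P.d * (ascPochhammer ℂ n).eval P.e)

/-- The value `₃F₂[a, b, c; d, e; 1]`. -/
noncomputable def F (P : HypParams) : ℂ := ∑' n, P.term n

/-- The parametric excess `s = d + e - a - b - c`. -/
def excess (P : HypParams) : ℂ := P.d + P.e - P.a - P.b - P.c

/-- The numbers `(2x₁, …, 2x₅)` for which the upper parameters are `2x₁ - s, 2x₂ - s, 2x₃ - s`
and the lower parameters are `2x₄, 2x₅`. -/
def hardy (P : HypParams) : Fin 5 → ℂ :=
  ![P.d + P.e - P.b - P.c, P.d + P.e - P.c - P.a, P.d + P.e - P.a - P.b, P.d, P.e]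

/-- Two arrays of parameters are related by one of the 120 Thomae relations: their tuples
`(x₁, …, x₅)` agree up to a permutation. -/
def ThomaeRelated (P Q : HypParams) : Prop :=
  ∃ σ : Equiv.Perm (Fin 5), ∀ t, Q.hardy t = P.hardy (σ t)

end HypParams

/-- The parameters of the left-hand side of the exotic identity. -/
def exoticLeft (α β γ : ℂ) : HypParams :=
  ⟨α + 1, β + 1, γ, 2 * α + β + 1, 2 * β + α + 1⟩

/-- The parameters of the right-hand side of the exotic identity. -/
def exoticRight (α β γ : ℂ) : HypParams :=
  ⟨α, β, γ, 2 * α + β + 1, 2 * β + α + 1⟩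

/-- The factor `2(α+β) / (2(α+β) - γ)` on the right-hand side of the exotic identity. -/
noncomputable def exoticFactor (α β γ : ℂ) : ℂ := 2 * (α + β) / (2 * (α + β) - γ)

/-- `2α+β+1` and `2β+α+1` are not non-positive integers, and `Re(2α+2β-γ) > 0`. -/
def ExoticAdmissible (α β γ : ℂ) : Prop :=
  (∀ n : ℕ, 2 * α + β + 1 ≠ -(n : ℂ)) ∧ (∀ n : ℕ, 2 * β + α + 1 ≠ -(n : ℂ)) ∧
    0 < (2 * α + 2 * β - γ).re

/-- Both series of the exotic identity converge, and the identity
`₃F₂[α+1, β+1, γ; 2α+β+1, 2β+α+1; 1]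
  = 2(α+β)/(2(α+β)-γ) · ₃F₂[α, β, γ; 2α+β+1, 2β+α+1; 1]` holds. -/
def ExoticIdentity (α β γ : ℂ) : Prop :=
  Summable (exoticLeft α β γ).term ∧ Summable (exoticRight α β γ).term ∧
    (exoticLeft α β γ).F = exoticFactor α β γ * (exoticRight α β γ).F

/-! ## The integrals, and the groups acting on their parameters -/

/-- The integral `I(h,i,j,k,l)` over the unit square, for `p = (h,i,j,k,l)`. -/
noncomputable def rvI (p : Fin 5 → ℕ) : ℝ :=
  ∫ z in Ioo (0 : ℝ) 1 ×ˢ Ioo (0 : ℝ) 1,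
    (z.1 ^ p 0 * (1 - z.1) ^ p 1 * z.2 ^ p 3 * (1 - z.2) ^ p 2) /
      (1 - z.1 * z.2) ^ ((p 1 : ℤ) + p 2 - p 4 + 1)

/-- The ten symbols `h, i, j, k, l, j+k-h, k+l-i, l+h-j, h+i-k, i+j-l`. -/
inductive RVSymbol
  | h | i | j | k | l | jkh | kli | lhj | hik | ijl
  deriving DecidableEq

namespace RVSymbol

/-- The linear form in `p = (h,i,j,k,l)` that a symbol denotes. -/
def value (p : Fin 5 → ℤ) : RVSymbol → ℤ
  | h => p 0
  | i => p 1
  | j => p 2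
  | k => p 3
  | l => p 4
  | jkh => p 2 + p 3 - p 0
  | kli => p 3 + p 4 - p 1
  | lhj => p 4 + p 0 - p 2
  | hik => p 0 + p 1 - p 3
  | ijl => p 1 + p 2 - p 4

/-- The five letters, in the order `h, i, j, k, l`. -/
def letter : Fin 5 → RVSymbol := ![h, i, j, k, l]

/-- `σ = (h k)(i j)`, extended by linearity to the ten symbols. -/
def sigma : Equiv.Perm RVSymbol :=
  Equiv.swap h k * Equiv.swap i j * Equiv.swap jkh hik * Equiv.swap kli lhj

/-- `τ = (h i j k l)` (that is `h ↦ i ↦ j ↦ k ↦ l ↦ h`), extended by linearity. -/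
def tau : Equiv.Perm RVSymbol :=
  List.formPerm [h, i, j, k, l] * List.formPerm [jkh, kli, lhj, hik, ijl]

/-- `φ = (h  i+j-l)(i  l+h-j)(j+k-h  k+l-i)`. -/
def phi : Equiv.Perm RVSymbol :=
  Equiv.swap h ijl * Equiv.swap i lhj * Equiv.swap jkh kli

/-- The group `T = ⟨σ, τ⟩`. -/
def groupT : Subgroup (Equiv.Perm RVSymbol) := Subgroup.closure {sigma, tau}

/-- The group `Φ = ⟨φ, σ, τ⟩`. -/
def groupPhi : Subgroup (Equiv.Perm RVSymbol) := Subgroup.closure {phi, sigma, tau}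

/-- The three generators act linearly: the image of each symbol is obtained by substituting
the images of the five letters into its linear form. -/
theorem value_generators (p : Fin 5 → ℤ) (ρ : Equiv.Perm RVSymbol)
    (hρ : ρ = sigma ∨ ρ = tau ∨ ρ = phi) (s : RVSymbol) :
    value p (ρ s) = value (fun t => value p (ρ (letter t))) s := by
  have hs : (∀ t, sigma t = match t with
      | h => k | i => j | j => i | k => h | l => l
      | jkh => hik | kli => lhj | lhj => kli | hik => jkh | ijl => ijl) := by
    intro t; cases t <;> decide
  have ht : (∀ t, tau t = match t with
      | h => i | i => j | j => k | k => l | l => h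
      | jkh => kli | kli => lhj | lhj => hik | hik => ijl | ijl => jkh) := by
    intro t; cases t <;> decide
  have hp : (∀ t, phi t = match t with
      | h => ijl | i => lhj | j => j | k => k | l => l
      | jkh => kli | kli => jkh | lhj => i | hik => hik | ijl => h) := by
    intro t; cases t <;> decide
  rcases hρ with h | h | h <;> subst h <;> cases s <;>
    simp [hs, ht, hp, letter, value] <;> ring

end RVSymbol

/-- Some `ρ` in the group `G` satisfies `ρ(h) = h', ρ(i) = i', ρ(j) = j', ρ(k) = k', ρ(l) = l'`,
where `p = (h,i,j,k,l)` and `q = (h',i',j',k',l')`. -/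
def RVRelated (G : Subgroup (Equiv.Perm RVSymbol)) (p q : Fin 5 → ℕ) : Prop :=
  ∃ ρ ∈ G, ∀ t, RVSymbol.value (fun u => (p u : ℤ)) (ρ (RVSymbol.letter t)) = (q t : ℤ)

/-- The numbers `j+k-h`, `k+l-i`, `l+h-j`, `h+i-k`, `i+j-l` are non-negative (and so are
`h, i, j, k, l`, since `p` takes values in `ℕ`). -/
def RVNonneg (p : Fin 5 → ℕ) : Prop :=
  ∀ s : RVSymbol, 0 ≤ RVSymbol.value (fun u => (p u : ℤ)) s

/-- A counterexample to part (i) of the Rhin–Viola conjecture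
"`I(p) = I(q)` implies that some `ρ ∈ T` maps `p` to `q`". -/
def IsCounterexampleI (p q : Fin 5 → ℕ) : Prop :=
  rvI p = rvI q ∧ ¬ RVRelated RVSymbol.groupT p q

/-- A counterexample to part (ii) of the Rhin–Viola conjecture "if all ten numbers are
non-negative both for `p` and for `q`, then `I(p) / I(q) ∈ ℚ` implies that some `ρ ∈ Φ` maps
`p` to `q`". -/
def IsCounterexampleII (p q : Fin 5 → ℕ) : Prop :=
  RVNonneg p ∧ RVNonneg q ∧ rvI q ≠ 0 ∧ (∃ r : ℚ, rvI p / rvI q = (r : ℝ)) ∧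
    ¬ RVRelated RVSymbol.groupPhi p q

/-! ## From integrals to series -/

/-- The parameters `[h+1, k+1, i+j-l+1; h+i+2, k+j+2]` of the `₃F₂`-series to which
`I(h,i,j,k,l)` is proportional. -/
def rvParams (p : Fin 5 → ℕ) : HypParams :=
  ⟨p 0 + 1, p 3 + 1, p 1 + p 2 - p 4 + 1, p 0 + p 1 + 2, p 3 + p 2 + 2⟩

/-- The factor `h! i! j! k! l! / (Γ(s) Γ(d) Γ(e))`, by which the series with parameters `P` has
to be multiplied to give `I(h,i,j,k,l)` when `P` is Thomae-related to `rvParams (h,i,j,k,l)`. -/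
noncomputable def thomaeFactor (p : Fin 5 → ℕ) (P : HypParams) : ℂ :=
  (∏ t, ((p t).factorial : ℂ)) /
    (Complex.Gamma P.excess * Complex.Gamma P.d * Complex.Gamma P.e)

/-- The relation `I(p) = r · I(q)` is the specialization at `(α, β, γ)` of the exotic identity:
the identity is applicable at `(α, β, γ)`; the series belonging to `I(p)` and to `I(q)` are
carried by Thomae's relations to its left-hand and to its right-hand side; the integrals are the
corresponding multiples of these sides; and these multiples turn
`F(left) = exoticFactor · F(right)` into `I(p) = r · I(q)`. -/
structure IsExoticSpecialization (p q : Fin 5 → ℕ) (r : ℚ) (α β γ : ℂ) : Prop where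
  admissible : ExoticAdmissible α β γ
  left_related : (rvParams p).ThomaeRelated (exoticLeft α β γ)
  right_related : (rvParams q).ThomaeRelated (exoticRight α β γ)
  left_eq : (rvI p : ℂ) = thomaeFactor p (exoticLeft α β γ) * (exoticLeft α β γ).F
  right_eq : (rvI q : ℂ) = thomaeFactor q (exoticRight α β γ) * (exoticRight α β γ).F
  factor_ne : thomaeFactor p (exoticLeft α β γ) ≠ 0
  factor_eq : thomaeFactor p (exoticLeft α β γ) * exoticFactor α β γ =
    r * thomaeFactor q (exoticRight α β γ)
  relation : rvI p = r * rvI q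

/-! ### Growth of Pochhammer symbols -/

/-! The exotic identity is a telescoping sum. With `L n`, `R n` the terms of its two series and S =
α + β, the combination (2S - γ) `L n` - 2S `R n` is the difference of consecutive values of -(γ + n)
`L n` (`exotic_term_recurrence`, `exotic_partial_sum`). Since `L n` is O(n^(-Re s - 1)) with s = 2S
- γ the excess, the boundary term tends to 0 exactly because Re s > 0
(`tendsto_natCast_add_mul_term`).

To pass from series to integrals, 1/(1 - xy)^(i+j-l+1) is expanded in powers of xy and integrated
termwise by beta integrals (`hasSum_rvTerm`). A birational change of variables shows that the
integral is invariant under cyclic rotation of (h,i,j,k,l) (`rvI_rotate`), which also preserves h!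
i! j! k! l!. Thomae's transformation itself is never needed: in every case a rotation brings the
array of the integral to the required side of the identity, up to the order of the upper and of the
lower parameters. Thomae-relatedness is a separate check on two 5-tuples.

Unrelatedness comes from an invariant: Φ acts linearly, so it can only permute the ten values of a
tuple. One value of the second tuple that is absent from the first excludes every element of Φ
(`not_rvRelated_groupPhi`).

The infinite family is the case (α, α, 2α); its integrals are positive and at most 4^(1-α), hence
take infinitely many values. -/

theorem ascPochhammer_eval_eq_prod (a : ℂ) (n : ℕ) :
    (ascPochhammer ℂ n).eval a = ∏ j ∈ Finset.range n, (a + j) := by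
  induction n with
  | zero => simp
  | succ n ih => rw [ascPochhammer_succ_eval, ih, Finset.prod_range_succ]

theorem gammaSeq_eq_div_ascPochhammer (a : ℂ) (n : ℕ) :
    Complex.GammaSeq a n = (n : ℂ) ^ a * n.factorial / (ascPochhammer ℂ (n + 1)).eval a := by
  rw [Complex.GammaSeq, ascPochhammer_eval_eq_prod]

/-- Euler's limit: n^a n!/(a)ₙ₊₁ converges to Γ(a), hence is bounded. No restriction on a is needed,
since at a pole both sides of the limit take the value 0 by convention. -/
theorem isBigO_inv_ascPochhammer (a : ℂ) :
    (fun n : ℕ => ((ascPochhammer ℂ (n + 1)).eval a)⁻¹) =O[atTop]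
      fun n : ℕ => ((n : ℝ) ^ a.re * n.factorial)⁻¹ := by
  have h1 : Complex.GammaSeq a =O[atTop] fun _ : ℕ => (1 : ℝ) :=
    (Complex.GammaSeq_tendsto_Gamma a).isBigO_one ℝ
  have h2 : (fun n : ℕ => ((n : ℂ) ^ a * n.factorial)⁻¹) =O[atTop]
      fun n : ℕ => ((n : ℝ) ^ a.re * n.factorial)⁻¹ := by
    refine Asymptotics.IsBigO.of_bound 1 ?_
    filter_upwards [eventually_gt_atTop 0] with n hn
    simp [Complex.norm_natCast_cpow_of_pos hn, abs_of_nonneg (Real.rpow_nonneg n.cast_nonneg a.re)]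
  refine ((h1.mul h2).congr' ?_ ?_)
  · filter_upwards [eventually_gt_atTop 0] with n hn
    have : (n : ℂ) ^ a ≠ 0 := by
      simp [Complex.cpow_eq_zero_iff, hn.ne']
    have hf : (n.factorial : ℂ) ≠ 0 := by exact_mod_cast n.factorial_ne_zero
    rw [gammaSeq_eq_div_ascPochhammer]
    field_simp
  · simp

theorem isBigO_ascPochhammer (a : ℂ) :
    (fun n : ℕ => (ascPochhammer ℂ (n + 1)).eval a) =O[atTop]
      fun n : ℕ => (n : ℝ) ^ a.re * n.factorial := by
  by_cases ha : ∃ m : ℕ, a = -m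
  -- At a pole of Γ the limit cannot be inverted, but then (a)ₙ₊₁ contains the factor a + m = 0 as
  -- soon as n ≥ m.
  · obtain ⟨m, rfl⟩ := ha
    refine (Asymptotics.isBigO_zero _ _).congr' ?_ EventuallyEq.rfl
    filter_upwards [eventually_ge_atTop m] with n hn
    rw [ascPochhammer_eval_eq_prod, eq_comm, Finset.prod_eq_zero_iff]
    exact ⟨m, by simpa using Nat.lt_succ_of_le hn, by simp⟩
  · push Not at ha
    have h1 : (fun n => (Complex.GammaSeq a n)⁻¹) =O[atTop] fun _ : ℕ => (1 : ℝ) :=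
      ((Complex.GammaSeq_tendsto_Gamma a).inv₀ (Complex.Gamma_ne_zero ha)).isBigO_one ℝ
    have h2 : (fun n : ℕ => ((n : ℂ) ^ a * n.factorial)) =O[atTop]
        fun n : ℕ => ((n : ℝ) ^ a.re * n.factorial) := by
      refine Asymptotics.IsBigO.of_bound 1 ?_
      filter_upwards [eventually_gt_atTop 0] with n hn
      simp [Complex.norm_natCast_cpow_of_pos hn, abs_of_nonneg (Real.rpow_nonneg n.cast_nonneg a.re)]
    refine ((h1.mul h2).congr' ?_ ?_)
    · filter_upwards [eventually_gt_atTop 0] with n hn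
      have : (n : ℂ) ^ a ≠ 0 := by
        simp [Complex.cpow_eq_zero_iff, hn.ne']
      have hf : (n.factorial : ℂ) ≠ 0 := by exact_mod_cast n.factorial_ne_zero
      rw [gammaSeq_eq_div_ascPochhammer]
      field_simp
    · simp

namespace HypParams

theorem isBigO_term_succ (P : HypParams) :
    (fun n : ℕ => P.term (n + 1)) =O[atTop] fun n : ℕ => (n : ℝ) ^ (-P.excess.re - 1) := by
  have hfac : (fun n : ℕ => ((n + 1).factorial : ℂ)⁻¹) =O[atTop]
      fun n : ℕ => ((n + 1).factorial : ℝ)⁻¹ :=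
    Asymptotics.IsBigO.of_bound 1 (Eventually.of_forall fun n => by simp)
  have h := ((((isBigO_ascPochhammer P.a).mul (isBigO_ascPochhammer P.b)).mul
    (isBigO_ascPochhammer P.c)).mul ((isBigO_inv_ascPochhammer P.d).mul
    (isBigO_inv_ascPochhammer P.e))).mul hfac
  refine (h.trans ?_).congr_left ?_
  · refine Asymptotics.IsBigO.of_bound 1 ?_
    filter_upwards [eventually_gt_atTop 0] with n hn
    have hn' : (0 : ℝ) < n := by exact_mod_cast hn
    have hf : (0 : ℝ) < n.factorial := by exact_mod_cast n.factorial_pos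
    rw [Real.norm_of_nonneg (by positivity), Real.norm_of_nonneg (by positivity), one_mul]
    have e : (n : ℝ) ^ (-P.excess.re - 1) = (n : ℝ) ^ P.a.re * (n : ℝ) ^ P.b.re * (n : ℝ) ^ P.c.re
        * (((n : ℝ) ^ P.d.re)⁻¹ * ((n : ℝ) ^ P.e.re)⁻¹) * (n : ℝ)⁻¹ := by
      rw [← Real.rpow_neg hn'.le, ← Real.rpow_neg hn'.le, ← Real.rpow_neg_one,
        ← Real.rpow_add hn', ← Real.rpow_add hn', ← Real.rpow_add hn', ← Real.rpow_add hn',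
        ← Real.rpow_add hn']
      congr 1
      simp only [excess, Complex.add_re, Complex.sub_re]
      ring
    -- Three factors n! stand over n!² (n+1)!, leaving 1/(n+1) ≤ 1/n: this is the -1 in the
    -- exponent.
    rw [e, Nat.factorial_succ, Nat.cast_mul]
    calc _ = (n : ℝ) ^ P.a.re * (n : ℝ) ^ P.b.re * (n : ℝ) ^ P.c.re
        * (((n : ℝ) ^ P.d.re)⁻¹ * ((n : ℝ) ^ P.e.re)⁻¹) * ((n + 1 : ℕ) : ℝ)⁻¹ := by
          field_simp
      _ ≤ _ := by gcongr; simp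
  · intro n
    simp only [term]
    ring

theorem summable_term (P : HypParams) (h : 0 < P.excess.re) : Summable P.term := by
  rw [← summable_nat_add_iff 1]
  exact summable_of_isBigO_nat (Real.summable_nat_rpow.2 (by linarith)) P.isBigO_term_succ

theorem tendsto_natCast_add_mul_term (P : HypParams) (h : 0 < P.excess.re) (z : ℂ) :
    Tendsto (fun n : ℕ => (z + n) * P.term n) atTop (𝓝 0) := by
  rw [← tendsto_add_atTop_iff_nat 1]
  have h1 : (fun n : ℕ => z + ((n + 1 : ℕ) : ℂ)) =O[atTop] fun n : ℕ => (n : ℝ) ^ (1 : ℝ) := by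
    refine Asymptotics.IsBigO.of_bound (‖z‖ + 2) ?_
    filter_upwards [eventually_ge_atTop 1] with n hn
    have hn' : (1 : ℝ) ≤ n := by exact_mod_cast hn
    rw [Real.rpow_one, Real.norm_natCast]
    refine (norm_add_le _ _).trans ?_
    rw [Complex.norm_natCast]
    push_cast
    nlinarith [norm_nonneg z]
  refine (h1.mul P.isBigO_term_succ).trans_tendsto ?_
  have h2 := (tendsto_rpow_neg_atTop h).comp (tendsto_natCast_atTop_atTop (R := ℝ))
  refine h2.congr' ?_
  filter_upwards [eventually_gt_atTop 0] with n hn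
  have hn' : (0 : ℝ) < n := by exact_mod_cast hn
  rw [Function.comp_apply, ← Real.rpow_add hn']
  congr 1
  ring

end HypParams

/-! ### The exotic identity -/

/-- Peels off the first factor, so that the Pochhammer symbols of α and α + 1 can be compared. -/
theorem ascPochhammer_succ_eval_left (a : ℂ) (n : ℕ) :
    (ascPochhammer ℂ (n + 1)).eval a = a * (ascPochhammer ℂ n).eval (a + 1) := by
  rw [ascPochhammer_succ_left]; simp

theorem ascPochhammer_eval_ne_zero {a : ℂ} (h : ∀ n : ℕ, a ≠ -(n : ℂ)) (n : ℕ) :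
    (ascPochhammer ℂ n).eval a ≠ 0 := by
  rw [ascPochhammer_eval_eq_prod, Finset.prod_ne_zero_iff]
  intro j _ hj
  exact h j (eq_neg_of_add_eq_zero_left hj)

/-- After division by common factors, with m = n + 1 and S = α + β, this is the polynomial identity
(2S+m)(α+m)(β+m) - 2Sαβ = m(2α+β+m)(2β+α+m). It is what singles out the lower parameters 2α+β+1 and
2β+α+1. -/
theorem exotic_term_recurrence {α β γ : ℂ} (hd : ∀ n : ℕ, 2 * α + β + 1 ≠ -(n : ℂ))
    (he : ∀ n : ℕ, 2 * β + α + 1 ≠ -(n : ℂ)) (n : ℕ) :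
    (2 * (α + β) + (n + 1)) * (exoticLeft α β γ).term (n + 1) -
      2 * (α + β) * (exoticRight α β γ).term (n + 1) = (γ + n) * (exoticLeft α β γ).term n := by
  have h1 := ascPochhammer_eval_ne_zero hd n
  have h2 := ascPochhammer_eval_ne_zero he n
  have h3 : 2 * α + β + 1 + n ≠ 0 := fun h => hd n (eq_neg_of_add_eq_zero_left h)
  have h4 : 2 * β + α + 1 + n ≠ 0 := fun h => he n (eq_neg_of_add_eq_zero_left h)
  have h5 : (n.factorial : ℂ) ≠ 0 := by exact_mod_cast n.factorial_ne_zero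
  have h6 : (n : ℂ) + 1 ≠ 0 := by exact_mod_cast n.succ_ne_zero
  simp only [HypParams.term, exoticLeft, exoticRight]
  rw [ascPochhammer_succ_eval_left α, ascPochhammer_succ_eval_left β,
    ascPochhammer_succ_eval n (α + 1), ascPochhammer_succ_eval n (β + 1),
    ascPochhammer_succ_eval n γ, ascPochhammer_succ_eval n (2 * α + β + 1),
    ascPochhammer_succ_eval n (2 * β + α + 1), Nat.factorial_succ]
  push_cast
  field_simp
  ring

theorem exotic_partial_sum {α β γ : ℂ} (hd : ∀ n : ℕ, 2 * α + β + 1 ≠ -(n : ℂ))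
    (he : ∀ n : ℕ, 2 * β + α + 1 ≠ -(n : ℂ)) (n : ℕ) :
    ∑ m ∈ Finset.range (n + 1), ((2 * (α + β) - γ) * (exoticLeft α β γ).term m -
      2 * (α + β) * (exoticRight α β γ).term m) = -((γ + n) * (exoticLeft α β γ).term n) := by
  induction n with
  | zero => simp [HypParams.term]
  | succ n ih =>
    rw [Finset.sum_range_succ, ih, ← exotic_term_recurrence hd he]
    push_cast
    ring

theorem exoticIdentity {α β γ : ℂ} (h : ExoticAdmissible α β γ) : ExoticIdentity α β γ := by
  obtain ⟨hd, he, hs⟩ := h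
  have hL : (exoticLeft α β γ).excess = 2 * α + 2 * β - γ := by
    simp only [HypParams.excess, exoticLeft]; ring
  have hR : (exoticRight α β γ).excess = 2 * α + 2 * β - γ + 2 := by
    simp only [HypParams.excess, exoticRight]; ring
  have sL := (exoticLeft α β γ).summable_term (by rwa [hL])
  have sR := (exoticRight α β γ).summable_term (by rw [hR, Complex.add_re, Complex.re_ofNat]; linarith)
  refine ⟨sL, sR, ?_⟩
  have hsum := ((sL.hasSum.mul_left (2 * (α + β) - γ)).sub
    (sR.hasSum.mul_left (2 * (α + β)))).tendsto_sum_nat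
  have hlim := ((exoticLeft α β γ).tendsto_natCast_add_mul_term (by rwa [hL]) γ).neg
  have key := tendsto_nhds_unique ((tendsto_add_atTop_iff_nat 1).2 hsum)
    (hlim.congr fun n => (exotic_partial_sum hd he n).symm)
  have hne : 2 * (α + β) - γ ≠ 0 := by
    intro h0
    rw [show 2 * α + 2 * β - γ = 2 * (α + β) - γ by ring, h0] at hs
    simp at hs
  rw [neg_zero, sub_eq_zero] at key
  rw [exoticFactor, div_mul_eq_mul_div, eq_div_iff hne, mul_comm]
  exact key

/-! ### Invariance of the integral under the rotation of its parameters -/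

/-- The birational transformation `(x, y) ↦ ((1-x)/(1-xy), 1-xy)` of the unit square. -/
noncomputable def squareRotation (z : ℝ × ℝ) : ℝ × ℝ :=
  ((1 - z.1) / (1 - z.1 * z.2), 1 - z.1 * z.2)

/-- The derivative of `squareRotation`. -/
noncomputable def fderivSquareRotation (z : ℝ × ℝ) : ℝ × ℝ →L[ℝ] ℝ × ℝ :=
  (Matrix.toLin (.finTwoProd ℝ) (.finTwoProd ℝ)
    !![(z.2 - 1) / (1 - z.1 * z.2) ^ 2, (1 - z.1) * z.1 / (1 - z.1 * z.2) ^ 2;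
      -z.2, -z.1]).toContinuousLinearMap

theorem one_sub_mul_pos {z : ℝ × ℝ} (hz : z ∈ Ioo (0 : ℝ) 1 ×ˢ Ioo (0 : ℝ) 1) :
    0 < 1 - z.1 * z.2 := by
  obtain ⟨⟨h1, h2⟩, h3, h4⟩ := hz
  nlinarith

theorem hasFDerivAt_squareRotation {z : ℝ × ℝ} (hz : 1 - z.1 * z.2 ≠ 0) :
    HasFDerivAt squareRotation (fderivSquareRotation z) z := by
  unfold fderivSquareRotation
  rw [Matrix.toLin_finTwoProd_toContinuousLinearMap]
  have hx : HasFDerivAt (fun z : ℝ × ℝ => z.1) (ContinuousLinearMap.fst ℝ ℝ ℝ) z := hasFDerivAt_fst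
  have hy : HasFDerivAt (fun z : ℝ × ℝ => z.2) (ContinuousLinearMap.snd ℝ ℝ ℝ) z := hasFDerivAt_snd
  have h2 := (hx.mul hy).const_sub 1
  have h1 := (hx.const_sub 1).mul ((hasDerivAt_inv hz).comp_hasFDerivAt z h2)
  convert! h1.prodMk h2 using 2
  · ext <;> simp <;> field_simp <;> ring
  · ext <;> simp

theorem det_fderivSquareRotation {z : ℝ × ℝ} (hz : 1 - z.1 * z.2 ≠ 0) :
    (fderivSquareRotation z).det = z.1 / (1 - z.1 * z.2) := by
  unfold fderivSquareRotation
  simp only [LinearMap.det_toContinuousLinearMap, LinearMap.det_toLin, Matrix.det_fin_two_of]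
  have hz' : 1 - z.2 * z.1 ≠ 0 := by rwa [mul_comm]
  field_simp
  ring

theorem one_sub_mul_squareRotation {z : ℝ × ℝ} (hz : 1 - z.1 * z.2 ≠ 0) :
    1 - (squareRotation z).1 * (squareRotation z).2 = z.1 := by
  simp only [squareRotation]
  field_simp
  ring

theorem injOn_squareRotation :
    InjOn squareRotation (Ioo (0 : ℝ) 1 ×ˢ Ioo (0 : ℝ) 1) := by
  intro z hz w hw h
  have h1 : z.1 = w.1 := by
    rw [← one_sub_mul_squareRotation (one_sub_mul_pos hz).ne', h,
      one_sub_mul_squareRotation (one_sub_mul_pos hw).ne']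
  have h2 : 1 - z.1 * z.2 = 1 - w.1 * w.2 := congrArg Prod.snd h
  have h3 : z.1 * z.2 = z.1 * w.2 := by rw [h1] at h2 ⊢; linarith
  exact Prod.ext h1 (mul_left_cancel₀ hz.1.1.ne' h3)

theorem image_squareRotation :
    squareRotation '' (Ioo (0 : ℝ) 1 ×ˢ Ioo (0 : ℝ) 1) = Ioo (0 : ℝ) 1 ×ˢ Ioo (0 : ℝ) 1 := by
  apply Subset.antisymm
  · rintro _ ⟨z, hz, rfl⟩
    have hp := one_sub_mul_pos hz
    obtain ⟨⟨h1, h2⟩, h3, h4⟩ := hz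
    refine ⟨⟨div_pos (by linarith) hp, ?_⟩, hp, ?_⟩
    · simp only [squareRotation]
      rw [div_lt_one hp]
      nlinarith
    · simp only [squareRotation]
      nlinarith [mul_pos h1 h3]
  · intro w hw
    have hp := one_sub_mul_pos hw
    obtain ⟨⟨h1, h2⟩, h3, h4⟩ := hw
    -- The inverse map: Y = 1 - xy and 1 - XY = x give x = 1 - XY and y = (1 - Y)/x.
    refine ⟨(1 - w.1 * w.2, (1 - w.2) / (1 - w.1 * w.2)), ⟨⟨hp, ?_⟩, ?_, ?_⟩, ?_⟩
    · simp only
      nlinarith [mul_pos h1 h3]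
    · exact div_pos (by linarith) hp
    · simp only
      rw [div_lt_one hp]
      nlinarith
    · have h5 : (1 - w.1 * w.2) * ((1 - w.2) / (1 - w.1 * w.2)) = 1 - w.2 := by
        field_simp
      simp only [squareRotation, h5]
      ext
      · have : w.2 ≠ 0 := h3.ne'
        simp only [sub_sub_cancel]
        field_simp
      · simp

/-- Under X = (1-x)/(1-xy), Y = 1-xy one has 1-X = x(1-y)/(1-xy), 1-Y = xy and 1-XY = x, so the map
permutes the factors of the integrand up to powers of x and 1-xy; the Jacobian x/(1-xy) supplies the
remaining ones. -/
theorem rvI_rotate (h i j k l : ℕ) : rvI ![h, i, j, k, l] = rvI ![l, h, i, j, k] := by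
  have hm : MeasurableSet (Ioo (0 : ℝ) 1 ×ˢ Ioo (0 : ℝ) 1) :=
    measurableSet_Ioo.prod measurableSet_Ioo
  unfold rvI
  -- The square becomes an image on both sides; the change of variables acts on the left integral,
  -- and the last rewrite restores the square on the right.
  rw [← image_squareRotation, integral_image_eq_integral_abs_det_fderiv_smul volume hm
    (fun z hz => (hasFDerivAt_squareRotation (one_sub_mul_pos hz).ne').hasFDerivWithinAt)
    injOn_squareRotation, image_squareRotation]
  refine setIntegral_congr_fun hm fun z hz => ?_
  have hp := one_sub_mul_pos hz
  rw [det_fderivSquareRotation hp.ne', one_sub_mul_squareRotation hp.ne',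
    abs_of_pos (div_pos hz.1.1 hp)]
  obtain ⟨⟨h1, h2⟩, h3, h4⟩ := hz
  have e1 : 1 - (squareRotation z).1 = z.1 * (1 - z.2) / (1 - z.1 * z.2) := by
    simp only [squareRotation]
    field_simp
    ring
  have e2 : 1 - (squareRotation z).2 = z.1 * z.2 := by simp [squareRotation]
  rw [e1, e2]
  simp only [squareRotation, Matrix.cons_val, smul_eq_mul]
  have g1 : z.1 ^ ((i : ℤ) + j - l + 1) = z.1 ^ i * z.1 ^ j * z.1 / z.1 ^ l := by
    rw [zpow_add₀ h1.ne', zpow_sub₀ h1.ne', zpow_add₀ h1.ne']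
    simp only [zpow_natCast, zpow_one]
    ring
  have g2 : (1 - z.1 * z.2) ^ ((h : ℤ) + i - k + 1) =
      (1 - z.1 * z.2) ^ h * (1 - z.1 * z.2) ^ i * (1 - z.1 * z.2) / (1 - z.1 * z.2) ^ k := by
    rw [zpow_add₀ hp.ne', zpow_sub₀ hp.ne', zpow_add₀ hp.ne']
    simp only [zpow_natCast, zpow_one]
    ring
  rw [g1, g2]
  simp only [div_pow, mul_pow]
  field_simp

/-! ### The integral as a multiple of a series -/

theorem ascPochhammer_eval_natCast_add_one (m n : ℕ) :
    (ascPochhammer ℂ n).eval ((m : ℂ) + 1) = (m + n).factorial / m.factorial := by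
  have hm : (m.factorial : ℂ) ≠ 0 := by exact_mod_cast m.factorial_ne_zero
  induction n with
  | zero => simp [hm]
  | succ n ih =>
    rw [ascPochhammer_succ_eval, ih, ← add_assoc, Nat.factorial_succ]
    push_cast
    field_simp
    ring

theorem integrableOn_pow_mul_one_sub_pow (a b : ℕ) :
    IntegrableOn (fun x : ℝ => x ^ a * (1 - x) ^ b) (Ioo 0 1) :=
  ((by fun_prop : Continuous fun x : ℝ => x ^ a * (1 - x) ^ b).integrableOn_Icc).mono_set
    Ioo_subset_Icc_self

theorem integral_pow_mul_one_sub_pow (a b : ℕ) :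
    ∫ x in Ioo (0 : ℝ) 1, x ^ a * (1 - x) ^ b =
      (a.factorial * b.factorial : ℝ) / (a + b + 1).factorial := by
  have h := Complex.betaIntegral_eq_Gamma_mul_div (a + 1) (b + 1)
    (by simp; positivity) (by simp; positivity)
  have e : (a : ℂ) + 1 + (b + 1) = ((a + b + 1 : ℕ) : ℂ) + 1 := by push_cast; ring
  rw [e, Complex.Gamma_nat_eq_factorial, Complex.Gamma_nat_eq_factorial,
    Complex.Gamma_nat_eq_factorial, Complex.betaIntegral,
    intervalIntegral.integral_of_le zero_le_one, integral_Ioc_eq_integral_Ioo] at h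
  simp only [add_sub_cancel_right, Complex.cpow_natCast] at h
  apply Complex.ofReal_injective
  rw [← integral_complex_ofReal]
  push_cast
  exact h

/-- The integral of the `n`-th term of the expansion of the integrand of `rvI p` in powers of
`x y`, where `c = i + j - l`. -/
noncomputable def rvTerm (p : Fin 5 → ℕ) (c n : ℕ) : ℝ :=
  (n + c).choose c *
    (((p 0 + n).factorial * (p 1).factorial / (p 0 + n + p 1 + 1).factorial) *
      ((p 3 + n).factorial * (p 2).factorial / (p 3 + n + p 2 + 1).factorial))

theorem rvTerm_pos (p : Fin 5 → ℕ) (c n : ℕ) : 0 < rvTerm p c n := by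
  have : 0 < (n + c).choose c := Nat.choose_pos (by omega)
  unfold rvTerm
  positivity

theorem excess_rvParams (p : Fin 5 → ℕ) : (rvParams p).excess = p 4 + 1 := by
  simp only [HypParams.excess, rvParams]
  ring

theorem ofReal_rvTerm {p : Fin 5 → ℕ} {c : ℕ} (hc : p 4 + c = p 1 + p 2) (n : ℕ) :
    (rvTerm p c n : ℂ) = thomaeFactor p (rvParams p) * (rvParams p).term n := by
  have hc' : (p 1 : ℂ) + p 2 - p 4 + 1 = c + 1 := by
    have : (p 4 : ℂ) + c = p 1 + p 2 := by exact_mod_cast hc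
    linear_combination -this
  have hd : (p 0 : ℂ) + p 1 + 2 = ((p 0 + p 1 + 1 : ℕ) : ℂ) + 1 := by push_cast; ring
  have he : (p 3 : ℂ) + p 2 + 2 = ((p 3 + p 2 + 1 : ℕ) : ℂ) + 1 := by push_cast; ring
  rw [thomaeFactor, excess_rvParams]
  simp only [HypParams.term, rvParams, rvTerm]
  rw [hc', hd, he]
  simp only [ascPochhammer_eval_natCast_add_one, Complex.Gamma_nat_eq_factorial, Fin.prod_univ_five]
  rw [show p 0 + n + p 1 + 1 = p 0 + p 1 + 1 + n by ring,
    show p 3 + n + p 2 + 1 = p 3 + p 2 + 1 + n by ring]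
  push_cast
  rw [Nat.cast_choose ℂ (Nat.le_add_left c n), Nat.add_sub_cancel, add_comm n c]
  have hf : ∀ m : ℕ, (m.factorial : ℂ) ≠ 0 := fun m => by exact_mod_cast m.factorial_ne_zero
  field_simp [hf]

theorem summable_rvTerm {p : Fin 5 → ℕ} {c : ℕ} (hc : p 4 + c = p 1 + p 2) :
    Summable (rvTerm p c) := by
  rw [← Complex.summable_ofReal]
  simp only [ofReal_rvTerm hc]
  refine ((rvParams p).summable_term ?_).mul_left _
  rw [excess_rvParams]
  simp
  positivity

/-- Sum and integral may be exchanged because the expanded terms are non-negative on the square and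
their integrals are summable, the excess being l + 1 > 0. -/
theorem hasSum_rvTerm {p : Fin 5 → ℕ} {c : ℕ} (hc : p 4 + c = p 1 + p 2) :
    HasSum (rvTerm p c) (rvI p) := by
  set S := Ioo (0 : ℝ) 1 ×ˢ Ioo (0 : ℝ) 1
  have hm : MeasurableSet S := measurableSet_Ioo.prod measurableSet_Ioo
  let F : ℕ → ℝ × ℝ → ℝ := fun n z => (n + c).choose c *
    ((z.1 ^ (p 0 + n) * (1 - z.1) ^ p 1) * (z.2 ^ (p 3 + n) * (1 - z.2) ^ p 2))
  have hint : ∀ n, Integrable (F n) (volume.restrict S) := fun n => by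
    rw [Measure.volume_eq_prod, ← Measure.prod_restrict]
    exact ((integrableOn_pow_mul_one_sub_pow (p 0 + n) (p 1)).mul_prod
      (integrableOn_pow_mul_one_sub_pow (p 3 + n) (p 2))).const_mul _
  have hval : ∀ n, ∫ z in S, F n z = rvTerm p c n := fun n => by
    simp only [F, integral_const_mul]
    rw [Measure.volume_eq_prod,
      setIntegral_prod_mul (fun x : ℝ => x ^ (p 0 + n) * (1 - x) ^ p 1)
        (fun y : ℝ => y ^ (p 3 + n) * (1 - y) ^ p 2), integral_pow_mul_one_sub_pow,
      integral_pow_mul_one_sub_pow, rvTerm]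
  have hnorm : ∀ n, ∫ z in S, ‖F n z‖ = rvTerm p c n := fun n => by
    rw [← hval n]
    refine setIntegral_congr_fun (g := F n) hm fun z hz => Real.norm_of_nonneg (r := F n z) ?_
    obtain ⟨⟨h1, h2⟩, h3, h4⟩ := hz
    have h5 : 0 < 1 - z.1 := by linarith
    have h6 : 0 < 1 - z.2 := by linarith
    positivity
  have hsum := hasSum_integral_of_summable_integral_norm hint
    (by simpa only [hnorm] using summable_rvTerm hc)
  simp only [hval] at hsum
  have hI : rvI p = ∫ z in S, ∑' n, F n z := by
    refine setIntegral_congr_fun hm fun z hz => ?_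
    have hp := one_sub_mul_pos hz
    obtain ⟨⟨h1, h2⟩, h3, h4⟩ := hz
    have hz1 : ‖z.1 * z.2‖ < 1 := by
      rw [Real.norm_of_nonneg (by positivity)]
      linarith
    have hg := (hasSum_choose_mul_geometric_of_norm_lt_one c hz1).mul_left
      (z.1 ^ p 0 * (1 - z.1) ^ p 1 * z.2 ^ p 3 * (1 - z.2) ^ p 2)
    have hexp : (p 1 : ℤ) + p 2 - p 4 + 1 = ((c + 1 : ℕ) : ℤ) := by
      push_cast
      have : (p 4 : ℤ) + c = p 1 + p 2 := by exact_mod_cast hc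
      linarith
    rw [hexp, zpow_natCast, div_eq_mul_one_div, ← hg.tsum_eq]
    refine tsum_congr fun n => ?_
    simp only [F, mul_pow, pow_add]
    ring
  rwa [hI]

theorem rvI_pos {p : Fin 5 → ℕ} (h : p 4 ≤ p 1 + p 2) : 0 < rvI p := by
  have hc : p 4 + (p 1 + p 2 - p 4) = p 1 + p 2 := by omega
  rw [← (hasSum_rvTerm hc).tsum_eq]
  exact (summable_rvTerm hc).tsum_pos (fun n => (rvTerm_pos _ _ n).le) 0 (rvTerm_pos _ _ 0)

theorem rvI_eq_thomaeFactor_mul {p : Fin 5 → ℕ} (h : p 4 ≤ p 1 + p 2) :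
    (rvI p : ℂ) = thomaeFactor p (rvParams p) * (rvParams p).F := by
  have hc : p 4 + (p 1 + p 2 - p 4) = p 1 + p 2 := by omega
  rw [← (hasSum_rvTerm hc).tsum_eq, Complex.ofReal_tsum, HypParams.F, ← tsum_mul_left]
  exact tsum_congr fun n => ofReal_rvTerm hc n

/-- If `rvI p` equals `rvI q` and the letters of `p` and `q` have the same product of factorials,
then the series for `rvI q`, with its parameters in any order, represents `rvI p`. -/
theorem rvI_eq_thomaeFactor_mul_of_rotation {p q : Fin 5 → ℕ} {P : HypParams}
    (hI : rvI p = rvI q) (hq : q 4 ≤ q 1 + q 2)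
    (hprod : ∏ t, ((p t).factorial : ℂ) = ∏ t, ((q t).factorial : ℂ))
    (hnum : ∀ n, (ascPochhammer ℂ n).eval P.a * (ascPochhammer ℂ n).eval P.b *
      (ascPochhammer ℂ n).eval P.c = (ascPochhammer ℂ n).eval (rvParams q).a *
      (ascPochhammer ℂ n).eval (rvParams q).b * (ascPochhammer ℂ n).eval (rvParams q).c)
    (hs : P.excess = (rvParams q).excess)
    (hden : P.d = (rvParams q).d ∧ P.e = (rvParams q).e ∨
      P.d = (rvParams q).e ∧ P.e = (rvParams q).d) :
    (rvI p : ℂ) = thomaeFactor p P * P.F := by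
  have hF : P.F = (rvParams q).F := by
    refine tsum_congr fun n => ?_
    rw [HypParams.term, HypParams.term, hnum]
    rcases hden with ⟨h1, h2⟩ | ⟨h1, h2⟩ <;> rw [h1, h2]
    ring
  have hf : thomaeFactor p P = thomaeFactor q (rvParams q) := by
    rw [thomaeFactor, thomaeFactor, hprod, hs]
    rcases hden with ⟨h1, h2⟩ | ⟨h1, h2⟩ <;> rw [h1, h2]
    ring
  rw [hI, hF, hf, rvI_eq_thomaeFactor_mul hq]

/-! ### Tuples that are not related -/

namespace RVSymbol

instance : Finite RVSymbol :=
  Finite.of_surjective ![h, i, j, k, l, jkh, kli, lhj, hik, ijl] fun s => by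
    cases s
    exacts [⟨0, rfl⟩, ⟨1, rfl⟩, ⟨2, rfl⟩, ⟨3, rfl⟩, ⟨4, rfl⟩, ⟨5, rfl⟩, ⟨6, rfl⟩, ⟨7, rfl⟩,
      ⟨8, rfl⟩, ⟨9, rfl⟩]

/-- A permutation of the symbols that respects the linear relations between them. -/
def ActsLinearly (ρ : Equiv.Perm RVSymbol) : Prop :=
  ∀ p s, value p (ρ s) = value (fun t => value p (ρ (letter t))) s

theorem ActsLinearly.one : ActsLinearly 1 := by
  intro p s
  cases s <;> simp [letter, value]

theorem ActsLinearly.mul {ρ π : Equiv.Perm RVSymbol} (hρ : ActsLinearly ρ)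
    (hπ : ActsLinearly π) : ActsLinearly (ρ * π) := by
  intro p s
  simp only [Equiv.Perm.mul_apply]
  rw [hρ, hπ]
  simp only [← hρ p]

theorem ActsLinearly.pow {ρ : Equiv.Perm RVSymbol} (hρ : ActsLinearly ρ) (n : ℕ) :
    ActsLinearly (ρ ^ n) := by
  induction n with
  | zero => simpa using ActsLinearly.one
  | succ n ih => rw [pow_succ]; exact ih.mul hρ

/-- There are finitely many symbols, so ρ has finite order and its inverse is a power of it. -/
theorem ActsLinearly.inv {ρ : Equiv.Perm RVSymbol} (hρ : ActsLinearly ρ) :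
    ActsLinearly ρ⁻¹ := by
  have h : ρ⁻¹ = ρ ^ (orderOf ρ - 1) := by
    rw [inv_eq_iff_mul_eq_one, ← pow_succ', Nat.sub_add_cancel (orderOf_pos ρ), pow_orderOf_eq_one]
  rw [h]
  exact hρ.pow _

theorem actsLinearly_of_mem_groupPhi {ρ : Equiv.Perm RVSymbol} (hρ : ρ ∈ groupPhi) :
    ActsLinearly ρ := by
  induction hρ using Subgroup.closure_induction with
  | mem x hx =>
    intro p s
    refine value_generators p x ?_ s
    rcases hx with rfl | rfl | rfl <;> simp
  | one => exact .one
  | mul x y _ _ hx hy => exact hx.mul hy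
  | inv x _ hx => exact hx.inv

theorem groupT_le_groupPhi : groupT ≤ groupPhi :=
  Subgroup.closure_mono fun _ hx => Or.inr hx

end RVSymbol

theorem not_rvRelated_groupPhi {p q : Fin 5 → ℕ} (s : RVSymbol)
    (h : ∀ t, RVSymbol.value (fun u => (p u : ℤ)) t ≠ RVSymbol.value (fun u => (q u : ℤ)) s) :
    ¬ RVRelated RVSymbol.groupPhi p q := by
  rintro ⟨ρ, hρ, hpq⟩
  apply h (ρ s)
  rw [RVSymbol.actsLinearly_of_mem_groupPhi hρ]
  simp only [hpq]

theorem isCounterexampleI_of_eq {p q : Fin 5 → ℕ} (hI : rvI p = rvI q)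
    (h : ¬ RVRelated RVSymbol.groupPhi p q) : IsCounterexampleI p q :=
  ⟨hI, fun ⟨ρ, hρ, hpq⟩ => h ⟨ρ, RVSymbol.groupT_le_groupPhi hρ, hpq⟩⟩

theorem isCounterexampleII_of_eq {p q : Fin 5 → ℕ} (hp : RVNonneg p) (hq : RVNonneg q) {r : ℚ}
    (hI : rvI p = r * rvI q) (h : ¬ RVRelated RVSymbol.groupPhi p q) :
    IsCounterexampleII p q := by
  have hpos : rvI q ≠ 0 := by
    -- i + j - l ≥ 0 is the condition under which the integral is a series of positive terms.
    have := hq .ijl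
    simp only [RVSymbol.value] at this
    exact (rvI_pos (by omega)).ne'
  exact ⟨hp, hq, hpos, ⟨r, by rw [hI, mul_div_cancel_right₀ _ hpos]⟩, h⟩

/-! ### Specializations of the exotic identity -/

theorem isExoticSpecialization_of {p q : Fin 5 → ℕ} {r : ℚ} {α β γ : ℂ}
    (admissible : ExoticAdmissible α β γ)
    (left_related : (rvParams p).ThomaeRelated (exoticLeft α β γ))
    (right_related : (rvParams q).ThomaeRelated (exoticRight α β γ))
    (left_eq : (rvI p : ℂ) = thomaeFactor p (exoticLeft α β γ) * (exoticLeft α β γ).F)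
    (right_eq : (rvI q : ℂ) = thomaeFactor q (exoticRight α β γ) * (exoticRight α β γ).F)
    (factor_ne : thomaeFactor p (exoticLeft α β γ) ≠ 0)
    (factor_eq : thomaeFactor p (exoticLeft α β γ) * exoticFactor α β γ =
      r * thomaeFactor q (exoticRight α β γ)) :
    IsExoticSpecialization p q r α β γ where
  admissible := admissible
  left_related := left_related
  right_related := right_related
  left_eq := left_eq
  right_eq := right_eq
  factor_ne := factor_ne
  factor_eq := factor_eq
  relation := by
    apply Complex.ofReal_injective
    push_cast
    rw [left_eq, right_eq, (exoticIdentity admissible).2.2, ← mul_assoc, factor_eq, mul_assoc]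

theorem exoticAdmissible_of_pos {a b : ℕ} {γ : ℂ} (h : γ.re < 2 * a + 2 * b) :
    ExoticAdmissible a b γ := by
  refine ⟨fun n hn => ?_, fun n hn => ?_, ?_⟩
  · have : ((2 * a + b + 1 + n : ℕ) : ℂ) = 0 := by push_cast; linear_combination hn
    exact absurd (Nat.cast_eq_zero.1 this) (by omega)
  · have : ((2 * b + a + 1 + n : ℕ) : ℂ) = 0 := by push_cast; linear_combination hn
    exact absurd (Nat.cast_eq_zero.1 this) (by omega)
  · simpa using h

theorem rvI_rotate_symm (h i j k l : ℕ) : rvI ![h, i, j, k, l] = rvI ![i, j, k, l, h] :=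
  (rvI_rotate i j k l h).symm

/-! ### The infinite family -/

theorem rvI_family_left (n : ℕ) :
    (rvI ![2 * n + 1, 2 * n + 1, n + 1, 2 * n + 1, n + 1] : ℂ) =
      thomaeFactor ![2 * n + 1, 2 * n + 1, n + 1, 2 * n + 1, n + 1]
        (exoticLeft (n + 1) (n + 1) (2 * n + 2)) *
      (exoticLeft (n + 1) (n + 1) (2 * n + 2)).F := by
  refine rvI_eq_thomaeFactor_mul_of_rotation (rvI_rotate_symm _ _ _ _ _) ?_ ?_ (fun m => ?_) ?_ ?_
  · simp
  · simp [Fin.prod_univ_five]; ring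
  · simp [exoticLeft, rvParams]; ring_nf
  · simp [HypParams.excess, exoticLeft, rvParams]; ring
  · left; simp [exoticLeft, rvParams]; constructor <;> ring

theorem rvI_family_right (n : ℕ) :
    (rvI ![2 * n + 3, 2 * n + 1, n + 1, 2 * n + 2, n] : ℂ) =
      thomaeFactor ![2 * n + 3, 2 * n + 1, n + 1, 2 * n + 2, n]
        (exoticRight (n + 1) (n + 1) (2 * n + 2)) *
      (exoticRight (n + 1) (n + 1) (2 * n + 2)).F := by
  refine rvI_eq_thomaeFactor_mul_of_rotation (rvI_rotate_symm _ _ _ _ _) ?_ ?_ (fun m => ?_) ?_ ?_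
  · simp; omega
  · simp [Fin.prod_univ_five]; ring
  · simp [exoticRight, rvParams]; ring_nf
  · simp [HypParams.excess, exoticRight, rvParams]; ring
  · left; simp [exoticRight, rvParams]; constructor <;> ring

/-- The exotic factor is 2 here, and the claim reduces to 2 (2n+1)! (n+1)! = (2n+2)! n!. -/
theorem thomaeFactor_family (n : ℕ) :
    thomaeFactor ![2 * n + 1, 2 * n + 1, n + 1, 2 * n + 1, n + 1]
        (exoticLeft (n + 1) (n + 1) (2 * n + 2)) * exoticFactor (n + 1) (n + 1) (2 * n + 2) =
      thomaeFactor ![2 * n + 3, 2 * n + 1, n + 1, 2 * n + 2, n]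
        (exoticRight (n + 1) (n + 1) (2 * n + 2)) := by
  have hL : (exoticLeft (n + 1) (n + 1) (2 * n + 2)).excess = ((2 * n + 1 : ℕ) : ℂ) + 1 := by
    simp only [HypParams.excess, exoticLeft]; push_cast; ring
  have hR : (exoticRight (n + 1) (n + 1) (2 * n + 2)).excess = ((2 * n + 3 : ℕ) : ℂ) + 1 := by
    simp only [HypParams.excess, exoticRight]; push_cast; ring
  have hd : (2 : ℂ) * (n + 1) + (n + 1) + 1 = ((3 * n + 3 : ℕ) : ℂ) + 1 := by push_cast; ring
  have hE : exoticFactor ((n : ℂ) + 1) (n + 1) (2 * n + 2) = 2 := by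
    have : (n : ℂ) + 1 ≠ 0 := by exact_mod_cast n.succ_ne_zero
    rw [exoticFactor, show (2 : ℂ) * ((n : ℂ) + 1 + (n + 1)) - (2 * n + 2) = 2 * (n + 1) by ring]
    field_simp
    ring
  rw [thomaeFactor, thomaeFactor, hL, hR, hE]
  simp only [exoticLeft, exoticRight, hd, Complex.Gamma_nat_eq_factorial, Fin.prod_univ_five,
    Matrix.cons_val]
  have hf : ∀ m : ℕ, (m.factorial : ℂ) ≠ 0 := fun m => by exact_mod_cast m.factorial_ne_zero
  field_simp [hf]
  rw [Nat.factorial_succ n, Nat.factorial_succ (2 * n + 1)]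
  push_cast
  ring

theorem rvI_family (n : ℕ) : rvI ![2 * n + 1, 2 * n + 1, n + 1, 2 * n + 1, n + 1] =
    rvI ![2 * n + 3, 2 * n + 1, n + 1, 2 * n + 2, n] := by
  have hadm : ExoticAdmissible ((n : ℂ) + 1) (n + 1) (2 * n + 2) := by
    have := exoticAdmissible_of_pos (a := n + 1) (b := n + 1) (γ := 2 * n + 2)
      (by simp; linarith [(n.cast_nonneg : (0 : ℝ) ≤ n)])
    exact_mod_cast this
  apply Complex.ofReal_injective
  rw [rvI_family_left, rvI_family_right, (exoticIdentity hadm).2.2, ← mul_assoc,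
    thomaeFactor_family]

theorem not_rvRelated_family (n : ℕ) :
    ¬ RVRelated RVSymbol.groupPhi ![2 * n + 1, 2 * n + 1, n + 1, 2 * n + 1, n + 1]
      ![2 * n + 3, 2 * n + 1, n + 1, 2 * n + 2, n] := by
  -- The second tuple has h' = 2n+3, while no value of the first exceeds 2n+1.
  refine not_rvRelated_groupPhi .h fun t => ?_
  cases t <;> simp [RVSymbol.value] <;> omega

theorem isCounterexampleI_family (n : ℕ) :
    IsCounterexampleI ![2 * n + 1, 2 * n + 1, n + 1, 2 * n + 1, n + 1]
      ![2 * n + 3, 2 * n + 1, n + 1, 2 * n + 2, n] :=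
  isCounterexampleI_of_eq (rvI_family n) (not_rvRelated_family n)

theorem isCounterexampleII_family (n : ℕ) :
    IsCounterexampleII ![2 * n + 1, 2 * n + 1, n + 1, 2 * n + 1, n + 1]
      ![2 * n + 3, 2 * n + 1, n + 1, 2 * n + 2, n] := by
  refine isCounterexampleII_of_eq (r := 1) (fun s => ?_) (fun s => ?_) (by simp [rvI_family n])
    (not_rvRelated_family n)
  all_goals cases s <;> simp [RVSymbol.value] <;> omega

/-- Both 1-x and 1-y are at most 1-xy, so 2n+1 factors 1-x and one factor 1-y absorb the denominator
(1-xy)^(2n+2). The n remaining factors 1-y, paired with y, give (y(1-y))^n ≤ 4^(-n). -/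
theorem rvI_family_le (n : ℕ) :
    rvI ![2 * n + 1, 2 * n + 1, n + 1, 2 * n + 1, n + 1] ≤ (1 / 4) ^ n := by
  have hm : MeasurableSet (Ioo (0 : ℝ) 1 ×ˢ Ioo (0 : ℝ) 1) :=
    measurableSet_Ioo.prod measurableSet_Ioo
  have hvol : volume (Ioo (0 : ℝ) 1 ×ˢ Ioo (0 : ℝ) 1) = 1 := by
    rw [Measure.volume_eq_prod, Measure.prod_prod]
    simp
  have key := norm_setIntegral_le_of_norm_le_const (μ := volume)
    (s := Ioo (0 : ℝ) 1 ×ˢ Ioo (0 : ℝ) 1) (C := (1 / 4 : ℝ) ^ n)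
    (f := fun z : ℝ × ℝ => (z.1 ^ (2 * n + 1) * (1 - z.1) ^ (2 * n + 1) * z.2 ^ (2 * n + 1) *
      (1 - z.2) ^ (n + 1)) / (1 - z.1 * z.2) ^ (2 * n + 2)) (by simp [hvol]) ?_
  · rw [measureReal_def, hvol, ENNReal.toReal_one, mul_one] at key
    refine le_trans (le_of_eq ?_) ((le_abs_self _).trans key)
    unfold rvI
    refine setIntegral_congr_fun hm fun z hz => ?_
    simp only [Matrix.cons_val]
    have hexp : ((2 * n + 1 : ℕ) : ℤ) + ((n + 1 : ℕ) : ℤ) - ((n + 1 : ℕ) : ℤ) + 1 =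
        ((2 * n + 2 : ℕ) : ℤ) := by push_cast; ring
    rw [hexp, zpow_natCast]
  · intro z hz
    have hp := one_sub_mul_pos hz
    obtain ⟨⟨h1, h2⟩, h3, h4⟩ := hz
    have h5 : 0 < 1 - z.1 := by linarith
    have h6 : 0 < 1 - z.2 := by linarith
    have h7 : 1 - z.1 ≤ 1 - z.1 * z.2 := by nlinarith
    have h8 : 1 - z.2 ≤ 1 - z.1 * z.2 := by nlinarith
    rw [Real.norm_of_nonneg (by positivity), div_le_iff₀ (by positivity)]
    have h9 : z.2 * (1 - z.2) ≤ 1 / 4 := by nlinarith [sq_nonneg (z.2 - 1 / 2)]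
    calc z.1 ^ (2 * n + 1) * (1 - z.1) ^ (2 * n + 1) * z.2 ^ (2 * n + 1) * (1 - z.2) ^ (n + 1)
        = z.1 ^ (2 * n + 1) * z.2 ^ (n + 1) * (z.2 * (1 - z.2)) ^ n *
          ((1 - z.1) ^ (2 * n + 1) * (1 - z.2)) := by
          rw [mul_pow]; ring
      _ ≤ 1 * 1 * (1 / 4) ^ n * ((1 - z.1 * z.2) ^ (2 * n + 1) * (1 - z.1 * z.2)) := by
          gcongr
          · exact pow_le_one₀ h1.le h2.le
          · exact pow_le_one₀ h3.le h4.le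
      _ = _ := by ring

theorem tendsto_rvI_family :
    Tendsto (fun n : ℕ => rvI ![2 * n + 1, 2 * n + 1, n + 1, 2 * n + 1, n + 1]) atTop (𝓝 0) :=
  squeeze_zero (fun _ => (rvI_pos (by simp)).le) rvI_family_le
    (tendsto_pow_atTop_nhds_zero_of_lt_one (by norm_num) (by norm_num))

/-- A finite range would have a least element, which is positive and so is eventually undercut. -/
theorem infinite_range_of_pos_of_tendsto_zero {u : ℕ → ℝ} (hpos : ∀ n, 0 < u n)
    (hlim : Tendsto u atTop (𝓝 0)) : (range u).Infinite := by
  intro hfin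
  obtain ⟨_, ⟨m, rfl⟩, hm⟩ := hfin.exists_minimal (range_nonempty u)
  obtain ⟨n, hn⟩ := (hlim.eventually_lt_const (hpos m)).exists
  exact absurd (hm ⟨n, rfl⟩ hn.le) (not_le.2 hn)

/-! ### Values at small parameters -/

theorem hasSum_one_div_add_sq (j : ℕ) :
    HasSum (fun n : ℕ => 1 / ((n : ℂ) + (j + 1)) ^ 2)
      (riemannZeta 2 - ∑ i ∈ Finset.range j, 1 / ((i : ℂ) + 1) ^ 2) := by
  have hs : Summable fun n : ℕ => 1 / (n : ℂ) ^ 2 := by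
    rw [← summable_norm_iff]
    simp
  have hz := zeta_nat_eq_tsum_of_gt_one (one_lt_two)
  rw [Nat.cast_ofNat] at hz
  have h := (hasSum_nat_add_iff' (j + 1)).2 hs.hasSum
  rw [← hz, Finset.sum_range_succ'] at h
  simpa [add_assoc] using h

theorem hasSum_one_div_add_sub (j : ℕ) :
    HasSum (fun n : ℕ => 1 / ((n : ℂ) + (j + 1)) - 1 / ((n : ℂ) + (j + 2))) (1 / ((j : ℂ) + 1)) := by
  -- Over the reals the terms are non-negative, so the limit of the telescoping partial sums
  -- suffices.
  have h : HasSum (fun n : ℕ => 1 / ((n : ℝ) + (j + 1)) - 1 / ((n : ℝ) + (j + 2)))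
      (1 / ((j : ℝ) + 1)) := by
    rw [hasSum_iff_tendsto_nat_of_nonneg]
    · have hsum : ∀ N : ℕ, ∑ n ∈ Finset.range N,
          (1 / ((n : ℝ) + (j + 1)) - 1 / ((n : ℝ) + (j + 2))) =
            1 / ((j : ℝ) + 1) - 1 / ((N : ℝ) + (j + 1)) := fun N => by
        have := Finset.sum_range_sub' (fun n : ℕ => 1 / ((n : ℝ) + (j + 1))) N
        push_cast at this
        rw [zero_add] at this
        rw [← this]
        refine Finset.sum_congr rfl fun n _ => ?_
        ring
      simp only [hsum]
      have h0 : Tendsto (fun N : ℕ => 1 / ((N : ℝ) + (j + 1))) atTop (𝓝 0) :=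
        tendsto_const_nhds.div_atTop
          (tendsto_atTop_add_const_right _ _ tendsto_natCast_atTop_atTop)
      simpa using h0.const_sub (1 / ((j : ℝ) + 1))
    · intro n
      rw [sub_nonneg]
      gcongr
      norm_num
  have h' := Complex.hasSum_ofReal.2 h
  push_cast at h'
  exact h'

theorem ascPochhammer_eval_small (n : ℕ) :
    (ascPochhammer ℂ n).eval 2 = (n + 1) * n.factorial ∧
    (ascPochhammer ℂ n).eval 3 = (n + 2) * (n + 1) * n.factorial / 2 ∧
    (ascPochhammer ℂ n).eval 4 = (n + 3) * (n + 2) * (n + 1) * n.factorial / 6 ∧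
    (ascPochhammer ℂ n).eval 5 = (n + 4) * (n + 3) * (n + 2) * (n + 1) * n.factorial / 24 ∧
    (ascPochhammer ℂ n).eval 6 =
      (n + 5) * (n + 4) * (n + 3) * (n + 2) * (n + 1) * n.factorial / 120 := by
  have h : ∀ m : ℕ, (ascPochhammer ℂ n).eval ((m : ℂ) + 1) = (n + m).factorial / m.factorial :=
    fun m => by rw [ascPochhammer_eval_natCast_add_one, add_comm]
  refine ⟨?_, ?_, ?_, ?_, ?_⟩
  · convert! h 1 using 1 <;> norm_num [Nat.factorial_succ]
  · convert! h 2 using 1 <;> (norm_num [Nat.factorial_succ]; try ring)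
  · convert! h 3 using 1 <;> (norm_num [Nat.factorial_succ]; try ring)
  · convert! h 4 using 1 <;> (norm_num [Nat.factorial_succ]; try ring)
  · convert! h 5 using 1 <;> (norm_num [Nat.factorial_succ]; try ring)

theorem complex_Gamma_small : Complex.Gamma 2 = 1 ∧ Complex.Gamma 3 = 2 ∧ Complex.Gamma 4 = 6 ∧
    Complex.Gamma 5 = 24 ∧ Complex.Gamma 6 = 120 := by
  have h := Complex.Gamma_nat_eq_factorial
  refine ⟨?_, ?_, ?_, ?_, ?_⟩
  · convert! h 1 using 2 <;> norm_num
  · convert! h 2 using 2 <;> norm_num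
  · convert! h 3 using 2 <;> norm_num [Nat.factorial_succ]
  · convert! h 4 using 2 <;> norm_num [Nat.factorial_succ]
  · convert! h 5 using 2 <;> norm_num [Nat.factorial_succ]

/-! ### Sato's five relations as specializations -/

theorem thomaeFactor_one_one_two :
    thomaeFactor ![1, 1, 1, 1, 1] (exoticLeft 1 1 2) = 1 / 36 := by
  obtain ⟨g2, g3, g4, g5, g6⟩ := complex_Gamma_small
  simp only [thomaeFactor, HypParams.excess, exoticLeft, Fin.prod_univ_five, Matrix.cons_val]
  norm_num [Nat.factorial_succ, g2, g3, g4, g5, g6]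

theorem isExoticSpecialization_one_one_two :
    IsExoticSpecialization ![1, 1, 1, 1, 1] ![3, 1, 1, 2, 0] 1 1 1 2 := by
  obtain ⟨g2, g3, g4, g5, g6⟩ := complex_Gamma_small
  have hL := thomaeFactor_one_one_two
  have hR : thomaeFactor ![3, 1, 1, 2, 0] (exoticRight 1 1 2) = 1 / 18 := by
    simp only [thomaeFactor, HypParams.excess, exoticRight, Fin.prod_univ_five, Matrix.cons_val]
    norm_num [Nat.factorial_succ, g2, g3, g4, g5, g6]
  refine isExoticSpecialization_of ?_ ?_ ?_ ?_ ?_ ?_ ?_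
  · have := exoticAdmissible_of_pos (a := 1) (b := 1) (γ := 2) (by norm_num)
    exact_mod_cast this
  · refine ⟨1, fun t => ?_⟩
    fin_cases t <;> simp [HypParams.hardy, rvParams, exoticLeft] <;> norm_num
  -- The tuples to be matched are (5,4,4,6,5) for the integral and (5,5,6,4,4) for the exotic side.
  -- The later permutations are likewise read off from equal entries.
  · refine ⟨⟨![0, 4, 3, 1, 2], ![0, 3, 4, 2, 1], by decide, by decide⟩, fun t => ?_⟩
    fin_cases t <;> simp [HypParams.hardy, rvParams, exoticRight] <;> norm_num
  · refine rvI_eq_thomaeFactor_mul_of_rotation rfl (by simp) rfl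
      (fun n => ?_) ?_ ?_ <;>
      simp only [HypParams.excess, exoticLeft, rvParams, Matrix.cons_val]
    · norm_num
    · norm_num
    · left; norm_num
  · refine rvI_eq_thomaeFactor_mul_of_rotation (rvI_rotate_symm _ _ _ _ _) (by simp) ?_
      (fun n => ?_) ?_ ?_ <;>
      simp only [HypParams.excess, exoticRight, rvParams, Fin.prod_univ_five, Matrix.cons_val]
    · ring
    · norm_num
      ring
    · norm_num
    · left; norm_num
  · rw [hL]; norm_num
  · rw [hL, hR, exoticFactor]; norm_num

theorem thomaeFactor_two_one_three :
    thomaeFactor ![3, 1, 2, 2, 1] (exoticLeft 2 1 3) = 1 / 240 := by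
  obtain ⟨g2, g3, g4, g5, g6⟩ := complex_Gamma_small
  simp only [thomaeFactor, HypParams.excess, exoticLeft, Fin.prod_univ_five, Matrix.cons_val]
  norm_num [Nat.factorial_succ, g2, g3, g4, g5, g6]

theorem isExoticSpecialization_two_one_three :
    IsExoticSpecialization ![3, 1, 2, 2, 1] ![4, 2, 2, 3, 0] 1 2 1 3 := by
  obtain ⟨g2, g3, g4, g5, g6⟩ := complex_Gamma_small
  have hL := thomaeFactor_two_one_three
  have hR : thomaeFactor ![4, 2, 2, 3, 0] (exoticRight 2 1 3) = 1 / 120 := by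
    simp only [thomaeFactor, HypParams.excess, exoticRight, Fin.prod_univ_five, Matrix.cons_val]
    norm_num [Nat.factorial_succ, g2, g3, g4, g5, g6]
  refine isExoticSpecialization_of ?_ ?_ ?_ ?_ ?_ ?_ ?_
  · have := exoticAdmissible_of_pos (a := 2) (b := 1) (γ := 3) (by norm_num)
    exact_mod_cast this
  · refine ⟨⟨![0, 1, 3, 4, 2], ![0, 1, 4, 2, 3], by decide, by decide⟩, fun t => ?_⟩
    fin_cases t <;> simp [HypParams.hardy, rvParams, exoticLeft] <;> norm_num
  · refine ⟨⟨![4, 0, 3, 2, 1], ![1, 4, 3, 2, 0], by decide, by decide⟩, fun t => ?_⟩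
    fin_cases t <;> simp [HypParams.hardy, rvParams, exoticRight] <;> norm_num
  -- Two rotations lead to (2,1,3,1,2), whose array is [3,2,3;5,6]; its lower parameters come in
  -- reverse order.
  · refine rvI_eq_thomaeFactor_mul_of_rotation 
      ((rvI_rotate _ _ _ _ _).trans (rvI_rotate _ _ _ _ _)) (by simp) ?_
      (fun n => ?_) ?_ ?_ <;>
      simp only [HypParams.excess, exoticLeft, rvParams, Fin.prod_univ_five, Matrix.cons_val]
    · ring
    · norm_num
    · norm_num
    · right; norm_num
  · refine rvI_eq_thomaeFactor_mul_of_rotation (rvI_rotate_symm _ _ _ _ _) (by simp) ?_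
      (fun n => ?_) ?_ ?_ <;>
      simp only [HypParams.excess, exoticRight, rvParams, Fin.prod_univ_five, Matrix.cons_val]
    · ring
    · norm_num
      ring
    · norm_num
    · left; norm_num
  · rw [hL]; norm_num
  · rw [hL, hR, exoticFactor]; norm_num

theorem thomaeFactor_two_one_four :
    thomaeFactor ![3, 1, 2, 1, 1] (exoticLeft 2 1 4) = 1 / 240 := by
  obtain ⟨g2, g3, g4, g5, g6⟩ := complex_Gamma_small
  simp only [thomaeFactor, HypParams.excess, exoticLeft, Fin.prod_univ_five, Matrix.cons_val]
  norm_num [Nat.factorial_succ, g2, g3, g4, g5, g6]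

theorem isExoticSpecialization_two_one_four :
    IsExoticSpecialization ![3, 1, 2, 1, 1] ![3, 3, 1, 3, 0] 1 2 1 4 := by
  obtain ⟨g2, g3, g4, g5, g6⟩ := complex_Gamma_small
  have hL := thomaeFactor_two_one_four
  have hR : thomaeFactor ![3, 3, 1, 3, 0] (exoticRight 2 1 4) = 1 / 80 := by
    simp only [thomaeFactor, HypParams.excess, exoticRight, Fin.prod_univ_five, Matrix.cons_val]
    norm_num [Nat.factorial_succ, g2, g3, g4, g5, g6]
  refine isExoticSpecialization_of ?_ ?_ ?_ ?_ ?_ ?_ ?_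
  · have := exoticAdmissible_of_pos (a := 2) (b := 1) (γ := 4) (by norm_num)
    exact_mod_cast this
  · refine ⟨⟨![2, 1, 0, 3, 4], ![2, 1, 0, 3, 4], by decide, by decide⟩, fun t => ?_⟩
    fin_cases t <;> simp [HypParams.hardy, rvParams, exoticLeft] <;> norm_num
  · refine ⟨⟨![2, 0, 3, 4, 1], ![1, 4, 0, 2, 3], by decide, by decide⟩, fun t => ?_⟩
    fin_cases t <;> simp [HypParams.hardy, rvParams, exoticRight] <;> norm_num
  · refine rvI_eq_thomaeFactor_mul_of_rotation rfl (by simp) rfl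
      (fun n => ?_) ?_ ?_ <;>
      simp only [HypParams.excess, exoticLeft, rvParams, Matrix.cons_val]
    · norm_num
      ring
    · norm_num
    · left; norm_num
  · refine rvI_eq_thomaeFactor_mul_of_rotation (rvI_rotate_symm _ _ _ _ _) (by simp) ?_
      (fun n => ?_) ?_ ?_ <;>
      simp only [HypParams.excess, exoticRight, rvParams, Fin.prod_univ_five, Matrix.cons_val]
    · ring
    · norm_num
      ring
    · norm_num
    · left; norm_num
  · rw [hL]; norm_num
  · rw [hL, hR, exoticFactor]; norm_num

theorem thomaeFactor_two_one_two :
    thomaeFactor ![3, 2, 2, 2, 1] (exoticLeft 2 1 2) = 1 / 360 := by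
  obtain ⟨g2, g3, g4, g5, g6⟩ := complex_Gamma_small
  simp only [thomaeFactor, HypParams.excess, exoticLeft, Fin.prod_univ_five, Matrix.cons_val]
  norm_num [Nat.factorial_succ, g2, g3, g4, g5, g6]

theorem isExoticSpecialization_two_one_two :
    IsExoticSpecialization ![3, 2, 2, 2, 1] ![5, 1, 3, 2, 1] 1 2 1 2 := by
  obtain ⟨g2, g3, g4, g5, g6⟩ := complex_Gamma_small
  have hL := thomaeFactor_two_one_two
  have hR : thomaeFactor ![5, 1, 3, 2, 1] (exoticRight 2 1 2) = 1 / 240 := by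
    simp only [thomaeFactor, HypParams.excess, exoticRight, Fin.prod_univ_five, Matrix.cons_val]
    norm_num [Nat.factorial_succ, g2, g3, g4, g5, g6]
  refine isExoticSpecialization_of ?_ ?_ ?_ ?_ ?_ ?_ ?_
  · have := exoticAdmissible_of_pos (a := 2) (b := 1) (γ := 2) (by norm_num)
    exact_mod_cast this
  · refine ⟨⟨![3, 0, 2, 4, 1], ![1, 4, 2, 0, 3], by decide, by decide⟩, fun t => ?_⟩
    fin_cases t <;> simp [HypParams.hardy, rvParams, exoticLeft] <;> norm_num
  · refine ⟨⟨![0, 4, 3, 2, 1], ![0, 4, 3, 2, 1], by decide, by decide⟩, fun t => ?_⟩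
    fin_cases t <;> simp [HypParams.hardy, rvParams, exoticRight] <;> norm_num
  · refine rvI_eq_thomaeFactor_mul_of_rotation 
      (rvI_rotate_symm _ _ _ _ _) (by simp) ?_
      (fun n => ?_) ?_ ?_ <;>
      simp only [HypParams.excess, exoticLeft, rvParams, Fin.prod_univ_five, Matrix.cons_val]
    · ring
    · norm_num
    · norm_num
    · left; norm_num
  · refine rvI_eq_thomaeFactor_mul_of_rotation (rvI_rotate_symm _ _ _ _ _) (by simp) ?_
      (fun n => ?_) ?_ ?_ <;>
      simp only [HypParams.excess, exoticRight, rvParams, Fin.prod_univ_five, Matrix.cons_val]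
    · ring
    · norm_num
      ring
    · norm_num
    · left; norm_num
  · rw [hL]; norm_num
  · rw [hL, hR, exoticFactor]; norm_num

theorem thomaeFactor_two_one_four' :
    thomaeFactor ![3, 0, 3, 1, 1] (exoticLeft 2 1 4) = 1 / 80 := by
  obtain ⟨g2, g3, g4, g5, g6⟩ := complex_Gamma_small
  simp only [thomaeFactor, HypParams.excess, exoticLeft, Fin.prod_univ_five, Matrix.cons_val]
  norm_num [Nat.factorial_succ, g2, g3, g4, g5, g6]

theorem isExoticSpecialization_two_one_four' :
    IsExoticSpecialization ![3, 0, 3, 1, 1] ![3, 3, 1, 2, 1] 9 2 1 4 := by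
  obtain ⟨g2, g3, g4, g5, g6⟩ := complex_Gamma_small
  have hL := thomaeFactor_two_one_four'
  have hR : thomaeFactor ![3, 3, 1, 2, 1] (exoticRight 2 1 4) = 1 / 240 := by
    simp only [thomaeFactor, HypParams.excess, exoticRight, Fin.prod_univ_five, Matrix.cons_val]
    norm_num [Nat.factorial_succ, g2, g3, g4, g5, g6]
  refine isExoticSpecialization_of ?_ ?_ ?_ ?_ ?_ ?_ ?_
  · have := exoticAdmissible_of_pos (a := 2) (b := 1) (γ := 4) (by norm_num)
    exact_mod_cast this
  · refine ⟨⟨![2, 1, 0, 4, 3], ![2, 1, 0, 4, 3], by decide, by decide⟩, fun t => ?_⟩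
    fin_cases t <;> simp [HypParams.hardy, rvParams, exoticLeft] <;> norm_num
  · refine ⟨⟨![0, 1, 3, 2, 4], ![0, 1, 3, 2, 4], by decide, by decide⟩, fun t => ?_⟩
    fin_cases t <;> simp [HypParams.hardy, rvParams, exoticRight] <;> norm_num
  · refine rvI_eq_thomaeFactor_mul_of_rotation rfl (by simp) rfl
      (fun n => ?_) ?_ ?_ <;>
      simp only [HypParams.excess, exoticLeft, rvParams, Matrix.cons_val]
    · norm_num
      ring
    · norm_num
    · right; norm_num
  · refine rvI_eq_thomaeFactor_mul_of_rotation (rvI_rotate_symm _ _ _ _ _) (by simp) ?_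
      (fun n => ?_) ?_ ?_ <;>
      simp only [HypParams.excess, exoticRight, rvParams, Fin.prod_univ_five, Matrix.cons_val]
    · ring
    · norm_num
      ring
    · norm_num
    · left; norm_num
  · rw [hL]; norm_num
  · rw [hL, hR, exoticFactor]; norm_num

/-! ### Closed forms of the left-hand series in terms of ζ(2) -/

theorem hasSum_exoticLeft_one_one_two :
    HasSum (exoticLeft 1 1 2).term (36 * (5 - 3 * riemannZeta 2)) := by
  -- Partial fractions of the term 36(n+1)/((n+2)²(n+3)²). The residues at the simple poles add up
  -- to 0, so these parts combine into telescoping differences; the double poles give ζ(2). The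
  -- other closed forms arise in the same way.
  have h := ((((hasSum_one_div_add_sub 1).mul_left (3)).add
    ((hasSum_one_div_add_sq 1).mul_left (-1))).add
    ((hasSum_one_div_add_sq 2).mul_left (-2))).mul_left 36
  convert! h using 1
  · ext n
    obtain ⟨p2, p3, p4, p5, p6⟩ := ascPochhammer_eval_small n
    have hf : (n.factorial : ℂ) ≠ 0 := by exact_mod_cast n.factorial_ne_zero
    have h1 : (n : ℂ) + 1 ≠ 0 := by exact_mod_cast (n + 0).succ_ne_zero
    have h2 : (n : ℂ) + 2 ≠ 0 := by exact_mod_cast (n + 1).succ_ne_zero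
    have h3 : (n : ℂ) + 3 ≠ 0 := by exact_mod_cast (n + 2).succ_ne_zero
    norm_num [HypParams.term, exoticLeft, p2, p3, p4, p5, p6]
    field_simp
    ring
  · norm_num [Finset.sum_range_succ]
    ring

theorem hasSum_exoticLeft_two_one_three :
    HasSum (exoticLeft 2 1 3).term (240 * (79 / 4 - 12 * riemannZeta 2)) := by
  have h := (((((hasSum_one_div_add_sub 2).mul_left (3)).add
    ((hasSum_one_div_add_sub 3).mul_left (1))).add
    ((hasSum_one_div_add_sq 2).mul_left (-1))).add
    ((hasSum_one_div_add_sq 3).mul_left (-3))).mul_left 720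
  convert! h using 1
  · ext n
    obtain ⟨p2, p3, p4, p5, p6⟩ := ascPochhammer_eval_small n
    have hf : (n.factorial : ℂ) ≠ 0 := by exact_mod_cast n.factorial_ne_zero
    have h1 : (n : ℂ) + 1 ≠ 0 := by exact_mod_cast (n + 0).succ_ne_zero
    have h2 : (n : ℂ) + 2 ≠ 0 := by exact_mod_cast (n + 1).succ_ne_zero
    have h3 : (n : ℂ) + 3 ≠ 0 := by exact_mod_cast (n + 2).succ_ne_zero
    have h4 : (n : ℂ) + 4 ≠ 0 := by exact_mod_cast (n + 3).succ_ne_zero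
    have h5 : (n : ℂ) + 5 ≠ 0 := by exact_mod_cast (n + 4).succ_ne_zero
    norm_num [HypParams.term, exoticLeft, p2, p3, p4, p5, p6]
    field_simp
    ring
  · norm_num [Finset.sum_range_succ]
    ring

theorem hasSum_exoticLeft_two_one_four :
    HasSum (exoticLeft 2 1 4).term (240 * (3 * riemannZeta 2 - 59 / 12)) := by
  have h := ((((hasSum_one_div_add_sub 2).mul_left (-1)).add
    ((hasSum_one_div_add_sub 3).mul_left (-2))).add
    ((hasSum_one_div_add_sq 3).mul_left (3))).mul_left 240
  convert! h using 1
  · ext n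
    obtain ⟨p2, p3, p4, p5, p6⟩ := ascPochhammer_eval_small n
    have hf : (n.factorial : ℂ) ≠ 0 := by exact_mod_cast n.factorial_ne_zero
    have h1 : (n : ℂ) + 1 ≠ 0 := by exact_mod_cast (n + 0).succ_ne_zero
    have h2 : (n : ℂ) + 2 ≠ 0 := by exact_mod_cast (n + 1).succ_ne_zero
    have h3 : (n : ℂ) + 3 ≠ 0 := by exact_mod_cast (n + 2).succ_ne_zero
    have h4 : (n : ℂ) + 4 ≠ 0 := by exact_mod_cast (n + 3).succ_ne_zero
    have h5 : (n : ℂ) + 5 ≠ 0 := by exact_mod_cast (n + 4).succ_ne_zero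
    norm_num [HypParams.term, exoticLeft, p2, p3, p4, p5, p6]
    field_simp
    ring
  · norm_num [Finset.sum_range_succ]
    ring

theorem hasSum_exoticLeft_two_one_two :
    HasSum (exoticLeft 2 1 2).term (360 * (10 * riemannZeta 2 - 148 / 9)) := by
  have h := ((((((hasSum_one_div_add_sub 1).mul_left (-1 / 12)).add
    ((hasSum_one_div_add_sub 2).mul_left (-25 / 12))).add
    ((hasSum_one_div_add_sub 3).mul_left (-1 / 3))).add
    ((hasSum_one_div_add_sq 2).mul_left (1))).add
    ((hasSum_one_div_add_sq 3).mul_left (3 / 2))).mul_left 1440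
  convert! h using 1
  · ext n
    obtain ⟨p2, p3, p4, p5, p6⟩ := ascPochhammer_eval_small n
    have hf : (n.factorial : ℂ) ≠ 0 := by exact_mod_cast n.factorial_ne_zero
    have h1 : (n : ℂ) + 1 ≠ 0 := by exact_mod_cast (n + 0).succ_ne_zero
    have h2 : (n : ℂ) + 2 ≠ 0 := by exact_mod_cast (n + 1).succ_ne_zero
    have h3 : (n : ℂ) + 3 ≠ 0 := by exact_mod_cast (n + 2).succ_ne_zero
    have h4 : (n : ℂ) + 4 ≠ 0 := by exact_mod_cast (n + 3).succ_ne_zero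
    have h5 : (n : ℂ) + 5 ≠ 0 := by exact_mod_cast (n + 4).succ_ne_zero
    norm_num [HypParams.term, exoticLeft, p2, p3, p4, p5, p6]
    field_simp
    ring
  · norm_num [Finset.sum_range_succ]
    ring

/-! ### The counterexamples assembled -/

theorem isCounterexampleI_of_isExoticSpecialization {p q : Fin 5 → ℕ} {α β γ : ℂ}
    (h : IsExoticSpecialization p q 1 α β γ) (hpq : ¬ RVRelated RVSymbol.groupPhi p q) :
    IsCounterexampleI p q :=
  isCounterexampleI_of_eq (by simpa using h.relation) hpq

theorem mainTheorem4 :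
    -- (i) the general identity, and the five relations of Sato as specializations of it
    ((∀ α β γ : ℂ, ExoticAdmissible α β γ → ExoticIdentity α β γ) ∧
      ((rvI ![1, 1, 1, 1, 1] : ℂ) = 5 - 3 * riemannZeta 2 ∧
        IsExoticSpecialization ![1, 1, 1, 1, 1] ![3, 1, 1, 2, 0] 1 1 1 2 ∧
        IsCounterexampleI ![1, 1, 1, 1, 1] ![3, 1, 1, 2, 0] ∧
        IsCounterexampleII ![1, 1, 1, 1, 1] ![3, 1, 1, 2, 0]) ∧
      ((rvI ![3, 1, 2, 2, 1] : ℂ) = 79 / 4 - 12 * riemannZeta 2 ∧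
        IsExoticSpecialization ![3, 1, 2, 2, 1] ![4, 2, 2, 3, 0] 1 2 1 3 ∧
        IsCounterexampleI ![3, 1, 2, 2, 1] ![4, 2, 2, 3, 0] ∧
        IsCounterexampleII ![3, 1, 2, 2, 1] ![4, 2, 2, 3, 0]) ∧
      ((rvI ![3, 1, 2, 1, 1] : ℂ) = 3 * riemannZeta 2 - 59 / 12 ∧
        IsExoticSpecialization ![3, 1, 2, 1, 1] ![3, 3, 1, 3, 0] 1 2 1 4 ∧
        IsCounterexampleI ![3, 1, 2, 1, 1] ![3, 3, 1, 3, 0] ∧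
        IsCounterexampleII ![3, 1, 2, 1, 1] ![3, 3, 1, 3, 0]) ∧
      ((rvI ![3, 2, 2, 2, 1] : ℂ) = 10 * riemannZeta 2 - 148 / 9 ∧
        IsExoticSpecialization ![3, 2, 2, 2, 1] ![5, 1, 3, 2, 1] 1 2 1 2 ∧
        IsCounterexampleI ![3, 2, 2, 2, 1] ![5, 1, 3, 2, 1] ∧
        IsCounterexampleII ![3, 2, 2, 2, 1] ![5, 1, 3, 2, 1]) ∧
      ((rvI ![3, 0, 3, 1, 1] : ℂ) = 9 * riemannZeta 2 - 59 / 4 ∧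
        IsExoticSpecialization ![3, 0, 3, 1, 1] ![3, 3, 1, 2, 1] 9 2 1 4 ∧
        IsCounterexampleII ![3, 0, 3, 1, 1] ![3, 3, 1, 2, 1])) ∧
    -- (ii) the infinite family
    (∀ α : ℕ, 1 ≤ α →
      rvI ![2 * α - 1, 2 * α - 1, α, 2 * α - 1, α] =
        rvI ![2 * α + 1, 2 * α - 1, α, 2 * α, α - 1] ∧
      IsCounterexampleI ![2 * α - 1, 2 * α - 1, α, 2 * α - 1, α]
        ![2 * α + 1, 2 * α - 1, α, 2 * α, α - 1] ∧
      IsCounterexampleII ![2 * α - 1, 2 * α - 1, α, 2 * α - 1, α]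
        ![2 * α + 1, 2 * α - 1, α, 2 * α, α - 1]) ∧
    -- the integrals tend to zero, and there are infinitely many counterexamples, even when
    -- they are counted by the values of the integrals
    Tendsto (fun α : ℕ => rvI ![2 * α - 1, 2 * α - 1, α, 2 * α - 1, α]) atTop (𝓝 0) ∧
    {x : ℝ | ∃ p q : Fin 5 → ℕ,
      IsCounterexampleI p q ∧ IsCounterexampleII p q ∧ rvI p = x}.Infinite := by
  have hfam : ∀ n : ℕ, 2 * (n + 1) - 1 = 2 * n + 1 ∧ 2 * (n + 1) + 1 = 2 * n + 3 ∧
      2 * (n + 1) = 2 * n + 2 ∧ n + 1 - 1 = n := fun n => by omega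
  refine ⟨⟨fun α β γ => exoticIdentity, ?_, ?_, ?_, ?_, ?_⟩, ?_, ?_, ?_⟩
  · have h := isExoticSpecialization_one_one_two
    have hn : ¬ RVRelated RVSymbol.groupPhi ![1, 1, 1, 1, 1] ![3, 1, 1, 2, 0] :=
      not_rvRelated_groupPhi .h (by intro t; cases t <;> decide)
    refine ⟨?_, h, isCounterexampleI_of_isExoticSpecialization h hn,
      isCounterexampleII_of_eq ?_ ?_ h.relation hn⟩
    · rw [h.left_eq, HypParams.F, hasSum_exoticLeft_one_one_two.tsum_eq,
        thomaeFactor_one_one_two]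
      ring
    all_goals intro s; cases s <;> decide
  · have h := isExoticSpecialization_two_one_three
    have hn : ¬ RVRelated RVSymbol.groupPhi ![3, 1, 2, 2, 1] ![4, 2, 2, 3, 0] :=
      not_rvRelated_groupPhi .h (by intro t; cases t <;> decide)
    refine ⟨?_, h, isCounterexampleI_of_isExoticSpecialization h hn,
      isCounterexampleII_of_eq ?_ ?_ h.relation hn⟩
    · rw [h.left_eq, HypParams.F, hasSum_exoticLeft_two_one_three.tsum_eq,
        thomaeFactor_two_one_three]
      ring
    all_goals intro s; cases s <;> decide
  · have h := isExoticSpecialization_two_one_four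
    have hn : ¬ RVRelated RVSymbol.groupPhi ![3, 1, 2, 1, 1] ![3, 3, 1, 3, 0] :=
      -- All letters of the second tuple occur among the values of the first, but i'+j'-l' = 4
      -- exceeds their maximum 3.
      not_rvRelated_groupPhi .ijl (by intro t; cases t <;> decide)
    refine ⟨?_, h, isCounterexampleI_of_isExoticSpecialization h hn,
      isCounterexampleII_of_eq ?_ ?_ h.relation hn⟩
    · rw [h.left_eq, HypParams.F, hasSum_exoticLeft_two_one_four.tsum_eq,
        thomaeFactor_two_one_four]
      ring
    all_goals intro s; cases s <;> decide
  · have h := isExoticSpecialization_two_one_two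
    have hn : ¬ RVRelated RVSymbol.groupPhi ![3, 2, 2, 2, 1] ![5, 1, 3, 2, 1] :=
      not_rvRelated_groupPhi .h (by intro t; cases t <;> decide)
    refine ⟨?_, h, isCounterexampleI_of_isExoticSpecialization h hn,
      isCounterexampleII_of_eq ?_ ?_ h.relation hn⟩
    · rw [h.left_eq, HypParams.F, hasSum_exoticLeft_two_one_two.tsum_eq,
        thomaeFactor_two_one_two]
      ring
    all_goals intro s; cases s <;> decide
  · have h := isExoticSpecialization_two_one_four'
    have hn : ¬ RVRelated RVSymbol.groupPhi ![3, 0, 3, 1, 1] ![3, 3, 1, 2, 1] :=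
      not_rvRelated_groupPhi .hik (by intro t; cases t <;> decide)
    refine ⟨?_, h, isCounterexampleII_of_eq ?_ ?_ h.relation hn⟩
    -- The third relation has the same (α, β, γ), so its series is reused; only the factor changes,
    -- from 1/240 to 1/80.
    · rw [h.left_eq, HypParams.F, hasSum_exoticLeft_two_one_four.tsum_eq,
        thomaeFactor_two_one_four']
      ring
    all_goals intro s; cases s <;> decide
  · intro α hα
    obtain ⟨n, rfl⟩ := Nat.exists_eq_add_of_le' hα
    obtain ⟨h1, h2, h3, h4⟩ := hfam n
    rw [h1, h2, h3, h4]
    exact ⟨rvI_family n, isCounterexampleI_family n, isCounterexampleII_family n⟩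
  · rw [← tendsto_add_atTop_iff_nat 1]
    refine tendsto_rvI_family.congr fun n => ?_
    rw [(hfam n).1]
  · refine (infinite_range_of_pos_of_tendsto_zero (fun _ => rvI_pos (by simp))
      tendsto_rvI_family).mono ?_
    rintro _ ⟨n, rfl⟩
    exact ⟨_, _, isCounterexampleI_family n, isCounterexampleII_family n, rfl⟩
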